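/- Let $\Sigma$ be a connected smooth 3-manifold (Hausdorff, $\sigma$-compact, without boundary) and $x_0\in\Sigma$. Let $\mathcal A^o$ be the space of smooth real-valued 1-forms on $\Sigma$, regarded as the $U(1)$-connections on the trivial bundle, and for a continuous, piecewise $C^1$ loop $\alpha$ based at $x_0$ and $A\in\mathcal A^o$ let $H(\alpha,A)=\exp\bigl(i\oint_\alpha A\bigr)\in U(1)$ be the holonomy. Two such loops belong to the same *hoop* if $H(\alpha,A)=H(\beta,A)$ for all $A\in\mathcal A^o$; the *trivial hoop* is the class of the constant loop. The *$U(1)$ holonomy C\*-algebra* $\overline{\mathcal{HA}}$ is the completion, in the sup norm over $\mathcal A^o$, of the $*$-algebra of finite complex linear combinations of the functions $T_\alpha\colon A\mapsto H(\alpha,A)$ (with pointwise product and complex conjugation as $*$). **Theorem A.5.** Let $\Gamma(\alpha)=1$ if $\alpha$ belongs to the trivial hoop and $\Gamma(\alpha)=0$ otherwise. There is a unique continuous linear functional $\Lambda$ on $\overline{\mathcal{HA}}$ with $\Lambda(T_\alpha)=\Gamma(\alpha)$ for all loops $\alpha$ based at $x_0$. It is positive, $\Lambda(f^*f)\ge 0$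 for all $f\in\overline{\mathcal{HA}}$, and strictly positive: $\Lambda(f^*f)>0$ for every $f\neq 0$. Consequently there is a unique regular Borel measure $\mu$ on the Gelfand spectrum of $\overline{\mathcal{HA}}$ with $\Lambda(f)=\int\chi(f)\,d\mu(\chi)$ for all $f\in\overline{\mathcal{HA}}$. It is a probability measure and is faithful: every non-empty open set has positive measure, and $f=0$ whenever the Gelfand transform of $f$ vanishes $\mu$-almost everywhere. Finally, $\Lambda$ and $\mu$ are diffeomorphism invariant: for every smooth diffeomorphism $\varphi$ of $\Sigma$ the formula $(\Phi f)(A)=f(\varphi^*A)$ defines a $*$-automorphism $\Phi$ of $\overline{\mathcal{HA}}$, one has $\Lambda\circ\Phi=\Lambda$, and $\mu$ is invariant under the induced map $\chi\mapsto\chi\circ\Phi$ of the spectrum. -/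

import Mathlib

open Set Filter Topology MeasureTheory Bundle
open scoped Manifold ContDiff ComplexOrder ENNReal

namespace U1Holonomy

noncomputable section

/-- Smooth real-valued one-forms on the 3-manifold `M`, i.e. smooth sections of `T*M`.  They are
identified with the smooth connections on the trivial `U(1)`-bundle over `M`. -/
abbrev OneForm (M : Type*) [TopologicalSpace M] [ChartedSpace (EuclideanSpace ℝ (Fin 3)) M]
    [IsManifold (𝓡 3) ∞ M] : Type _ :=
  ContMDiffSection (𝓡 3) (EuclideanSpace ℝ (Fin 3) →L[ℝ] ℝ) ∞
    (fun x : M => TangentSpace (𝓡 3) x →L[ℝ] Bundle.Trivial M ℝ x)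

section Geometry

set_option linter.unusedSectionVars false

variable {M : Type*} [TopologicalSpace M] [ChartedSpace (EuclideanSpace ℝ (Fin 3)) M]
  [IsManifold (𝓡 3) ∞ M]

/-! ### Pull-back of one-forms under diffeomorphisms -/

/-- The value `(φ^*A)_x = A_{φ(x)} ∘ dφ_x` of the pulled back one-form. -/
def OneForm.pullbackAt (φ : M ≃ₘ^∞⟮𝓡 3, 𝓡 3⟯ M) (A : OneForm M) (x : M) :
    TangentSpace (𝓡 3) x →L[ℝ] Bundle.Trivial M ℝ x :=
  (A (φ x)).comp (mfderiv (𝓡 3) (𝓡 3) φ x)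

lemma OneForm.contMDiff_pullbackAt (φ : M ≃ₘ^∞⟮𝓡 3, 𝓡 3⟯ M) (A : OneForm M) : 
   ContMDiff (𝓡 3) ((𝓡 3).prod 𝓘(ℝ, EuclideanSpace ℝ (Fin 3) →L[ℝ] ℝ)) ∞
    (fun x => TotalSpace.mk' (EuclideanSpace ℝ (Fin 3) →L[ℝ] ℝ) (E := fun x : M => TangentSpace (𝓡 3) x →L[ℝ] Bundle.Trivial M ℝ x) x (OneForm.pullbackAt φ A x)) := by
  intro x₀
  rw [contMDiffAt_hom_bundle]
  refine ⟨contMDiffAt_id, ?_⟩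
  have h1 := ContMDiffAt.mfderiv_const (m := ∞) (φ.contMDiff x₀) (by simp)
  have h2 := (contMDiffAt_hom_bundle _).1 (A.contMDiff (φ x₀))
  have h3 := ContMDiffAt.comp x₀ h2.2 (φ.contMDiff x₀)
  have h4 := h3.clm_comp h1
  refine h4.congr_of_eventuallyEq ?_
  have hb : ∀ᶠ x in 𝓝 x₀, φ x ∈ (trivializationAt (EuclideanSpace ℝ (Fin 3))
      (TangentSpace (𝓡 3) : M → Type _) (φ x₀)).baseSet :=
    φ.continuous.continuousAt.eventually ((trivializationAt (EuclideanSpace ℝ (Fin 3))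
      (TangentSpace (𝓡 3) : M → Type _) (φ x₀)).open_baseSet.mem_nhds
        (FiberBundle.mem_baseSet_trivializationAt' (φ x₀)))
  filter_upwards [hb] with x hx
  ext1 v
  simp only [inTangentCoordinates, ContinuousLinearMap.inCoordinates, Function.comp_apply, OneForm.pullbackAt,
    ContinuousLinearMap.comp_apply, id_eq]
  rw [Trivialization.symmL_continuousLinearMapAt _ hx]
  rfl


/-- The pull-back `φ^*A` of a smooth one-form under a diffeomorphism. -/
def OneForm.pullback (φ : M ≃ₘ^∞⟮𝓡 3, 𝓡 3⟯ M) (A : OneForm M) : OneForm M where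
  toFun x := OneForm.pullbackAt φ A x
  contMDiff_toFun := OneForm.contMDiff_pullbackAt φ A

/-! ### Line integrals and piecewise `C¹` paths -/

/-- The integrand `A_{γ(t)}(γ'(t))` of the line integral of the one-form `A` along `γ`. -/
def integrand (A : OneForm M) (γ : ℝ → M) (t : ℝ) : ℝ :=
  A (γ t) (mfderiv 𝓘(ℝ, ℝ) (𝓡 3) γ t (1 : ℝ))

lemma integrand_congr (A : OneForm M) {γ γ' : ℝ → M} {t : ℝ} (h : γ =ᶠ[𝓝 t] γ') :
    integrand A γ t = integrand A γ' t := by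
  have h0 : γ t = γ' t := h.eq_of_nhds
  unfold integrand
  rw [h.mfderiv_eq]
  congr! 2

lemma integrand_comp_affine (A : OneForm M) (γ : ℝ → M) {a : ℝ} (ha : a ≠ 0) (b t : ℝ) :
    integrand A (fun u => γ (a * u + b)) t = a * integrand A γ (a * t + b) := by
  unfold integrand
  have hf : ∀ t, HasMFDerivAt 𝓘(ℝ, ℝ) 𝓘(ℝ, ℝ) (fun u : ℝ => a * u + b) t
      (a • ContinuousLinearMap.id ℝ ℝ) := by
    intro t
    have h := (((hasDerivAt_id t).const_mul a).add_const b).hasFDerivAt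
    exact (h.congr_fderiv (by ext; simp)).hasMFDerivAt
  by_cases hd : MDifferentiableAt 𝓘(ℝ, ℝ) (𝓡 3) γ (a * t + b)
  · have := (HasMFDerivAt.comp t (hd.hasMFDerivAt) (hf t)).mfderiv
    have h2 : mfderiv 𝓘(ℝ, ℝ) (𝓡 3) (fun u => γ (a * u + b)) t (1 : ℝ) =
      a • (mfderiv 𝓘(ℝ, ℝ) (𝓡 3) γ (a * t + b) (1 : ℝ)) := by
      change mfderiv 𝓘(ℝ, ℝ) (𝓡 3) (γ ∘ (fun u => (a * u + b))) t (1 : ℝ) = _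
      rw [this]
      change mfderiv 𝓘(ℝ, ℝ) (𝓡 3) γ (a * t + b) (a • (1 : ℝ)) = _
      exact map_smul _ _ _
    rw [h2]
    exact map_smul (A (γ (a * t + b))) _ _
  · have hd' : ¬ MDifferentiableAt 𝓘(ℝ, ℝ) (𝓡 3) (fun u => γ (a * u + b)) t := by
      intro h
      apply hd
      have hg : MDifferentiableAt 𝓘(ℝ, ℝ) 𝓘(ℝ, ℝ) (fun u : ℝ => (u - b) / a) (a * t + b) := by
        rw [mdifferentiableAt_iff_differentiableAt]; fun_prop
      have e : (a * t + b - b) / a = t := by field_simp; ring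
      have := MDifferentiableAt.comp (a * t + b) (g := fun u => γ (a * u + b))
        (f := fun u : ℝ => (u - b) / a) (by rw [e]; exact h) hg
      convert this using 1
      ext u; simp; congr 1; field_simp; ring
    rw [mfderiv_zero_of_not_mdifferentiableAt hd, mfderiv_zero_of_not_mdifferentiableAt hd']
    change A (γ (a * t + b)) (0 : TangentSpace (𝓡 3) (γ (a * t + b))) = a * A (γ (a * t + b)) (0 : TangentSpace (𝓡 3) (γ (a * t + b)))
    rw [map_zero]; simp

lemma intervalIntegrable_integrand (A : OneForm M) {γ : ℝ → M} {a b : ℝ} (hab : a ≤ b)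
    (h : ContMDiffOn 𝓘(ℝ, ℝ) (𝓡 3) 1 γ (Icc a b)) :
    IntervalIntegrable (integrand A γ) volume a b := by
  rcases hab.eq_or_lt with rfl | hab'
  · simp
  have hu : UniqueMDiffOn 𝓘(ℝ, ℝ) (Icc a b) := (uniqueDiffOn_Icc hab').uniqueMDiffOn
  have h1 := h.continuousOn_tangentMapWithin le_rfl hu
  have h2 : ContinuousOn (fun t : ℝ => tangentMapWithin 𝓘(ℝ, ℝ) (𝓡 3) γ (Icc a b) ⟨t, (1:ℝ)⟩) (Icc a b) := by
    refine h1.comp (f := fun t : ℝ => (⟨t, (1:ℝ)⟩ : TangentBundle 𝓘(ℝ, ℝ) ℝ)) ?_ (fun t ht => ht)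
    apply Continuous.continuousOn
    exact (tangentBundleModelSpaceHomeomorph 𝓘(ℝ, ℝ)).symm.continuous.comp
      (continuous_id.prodMk continuous_const)
  have h3 : ContinuousOn (fun t : ℝ => TotalSpace.mk' ℝ (E := Bundle.Trivial M ℝ) (γ t) (A (γ t) (mfderivWithin 𝓘(ℝ, ℝ) (𝓡 3) γ (Icc a b) t (1:ℝ)))) (Icc a b) := by
    refine ContinuousOn.clm_bundle_apply (F₁ := EuclideanSpace ℝ (Fin 3)) (ϕ := fun t => A (γ t)) ?_ h2
    exact A.contMDiff.continuous.comp_continuousOn h.continuousOn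
  have h4 : ContinuousOn (fun t : ℝ => A (γ t) (mfderivWithin 𝓘(ℝ, ℝ) (𝓡 3) γ (Icc a b) t (1:ℝ))) (Icc a b) :=
    (continuous_snd.comp (Bundle.Trivial.homeomorphProd M ℝ).continuous).comp_continuousOn h3
  have h5 : IntervalIntegrable (fun t : ℝ => A (γ t) (mfderivWithin 𝓘(ℝ, ℝ) (𝓡 3) γ (Icc a b) t (1:ℝ))) volume a b := 
    ContinuousOn.intervalIntegrable_of_Icc hab h4
  refine h5.congr_uIoo fun t ht => ?_
  rw [uIoo_of_le hab] at ht
  simp only [integrand]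
  rw [mfderivWithin_of_mem_nhds (Icc_mem_nhds ht.1 ht.2)]

/-- The line integral `∮_γ A`; the finitely many break points of a piecewise `C¹` path form a
null set, so they do not contribute. -/
def lineIntegral (A : OneForm M) {x y : M} (γ : Path x y) : ℝ :=
  ∫ t in (0 : ℝ)..1, integrand A γ.extend t

/-- A (continuous) path `γ : [0, 1] → M` is piecewise `C¹` if there is a partition
`0 = s₀ ≤ s₁ ≤ ⋯ ≤ sₙ = 1` such that `γ` is `C¹` on each closed interval `[sₖ, sₖ₊₁]`
(one-sided at the end points). -/
def IsPiecewiseC1 {x y : M} (γ : Path x y) : Prop :=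
  ∃ (n : ℕ) (s : ℕ → ℝ), Monotone s ∧ s 0 = 0 ∧ s n = 1 ∧
    ∀ k < n, ContMDiffOn 𝓘(ℝ, ℝ) (𝓡 3) 1 γ.extend (Icc (s k) (s (k + 1)))

lemma IsPiecewiseC1.refl (x : M) : IsPiecewiseC1 (Path.refl x) := by
  refine ⟨1, fun k => min k 1, ?_, by simp, by simp, fun k _ => ?_⟩
  · intro a b h
    have : (a : ℝ) ≤ b := by exact_mod_cast h
    exact min_le_min_right 1 this
  · rw [Path.refl_extend]
    exact contMDiffOn_const

lemma IsPiecewiseC1.symm {x y : M} {γ : Path x y} (h : IsPiecewiseC1 γ) :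
    IsPiecewiseC1 γ.symm := by
  obtain ⟨n, s, hs, h0, h1, hk⟩ := h
  refine ⟨n, fun k => 1 - s (n - k), ?_, by simp [h1], by simp [h0], fun k hkn => ?_⟩
  · intro a b hab
    have := hs (show n - b ≤ n - a by omega)
    linarith
  · rw [Path.extend_symm]
    have e : n - k = n - (k + 1) + 1 := by omega
    refine (hk (n - (k + 1)) (by omega)).comp (t := Icc _ _) (f := fun t : ℝ => 1 - t) ?_ ?_
    · exact ContDiff.contMDiff (by fun_prop) |>.contMDiffOn
    · intro t ht
      simp only [mem_preimage, mem_Icc, e] at ht ⊢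
      constructor <;> linarith [ht.1, ht.2]

lemma IsPiecewiseC1.trans {x y z : M} {γ : Path x y} {γ' : Path y z} (h : IsPiecewiseC1 γ)
    (h' : IsPiecewiseC1 γ') : IsPiecewiseC1 (γ.trans γ') := by
  obtain ⟨n, s, hs, h0, h1, hk⟩ := h
  obtain ⟨n', s', hs', h0', h1', hk'⟩ := h'
  refine ⟨n + n', fun k => if k ≤ n then s k / 2 else (1 + s' (k - n)) / 2, ?_, by simp [h0], ?_,
    fun k hkn => ?_⟩
  · intro a b hab
    dsimp only
    have hn : ∀ k ≤ n, s k ≤ 1 := fun k hk => h1 ▸ hs hk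
    have hn' : ∀ k, 0 ≤ s' k := fun k => h0' ▸ hs' (Nat.zero_le k)
    split_ifs with ha hb hb
    · linarith [hs hab]
    · linarith [hn a ha, hn' (b - n)]
    · omega
    · linarith [hs' (show a - n ≤ b - n by omega)]
  · have : n' ≠ 0 := by
      rintro rfl
      rw [h0'] at h1'
      exact zero_ne_one h1'
    simp [this, h1']
  · dsimp only
    rcases lt_or_ge k n with hlt | hge
    · rw [if_pos hlt.le, if_pos (show k + 1 ≤ n by omega)]
      have h2 : s (k + 1) ≤ 1 := h1 ▸ hs (show k + 1 ≤ n by omega)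
      refine ContMDiffOn.congr ((hk k hlt).comp (t := Icc _ _) (f := fun t : ℝ => 2 * t)
        (ContDiff.contMDiff (by fun_prop)).contMDiffOn ?_) ?_
      · intro t ht
        simp only [mem_preimage, mem_Icc] at ht ⊢
        constructor <;> linarith [ht.1, ht.2]
      · intro t ht
        exact Path.extend_trans_of_le_half _ _ (by linarith [ht.2])
    · have e : (if k ≤ n then s k / 2 else (1 + s' (k - n)) / 2) = (1 + s' (k - n)) / 2 := by
        split_ifs with hh
        · have : k = n := by omega
          subst this
          simp [h1, h0']
        · rfl
      rw [e, if_neg (by omega), show k + 1 - n = k - n + 1 by omega]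
      have h2 : 0 ≤ s' (k - n) := h0' ▸ hs' (Nat.zero_le _)
      refine ContMDiffOn.congr ((hk' (k - n) (by omega)).comp (t := Icc _ _)
        (f := fun t : ℝ => 2 * t - 1) (ContDiff.contMDiff (by fun_prop)).contMDiffOn ?_) ?_
      · intro t ht
        simp only [mem_preimage, mem_Icc] at ht ⊢
        constructor <;> linarith [ht.1, ht.2]
      · intro t ht
        exact Path.extend_trans_of_half_le _ _ (by linarith [ht.1])

lemma IsPiecewiseC1.intervalIntegrable (A : OneForm M) {x y : M} {γ : Path x y}
    (h : IsPiecewiseC1 γ) : IntervalIntegrable (integrand A γ.extend) volume 0 1 := by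
  obtain ⟨n, s, hs, h0, h1, hk⟩ := h
  rw [← h0, ← h1]
  exact IntervalIntegrable.trans_iterate fun k hkn => intervalIntegrable_integrand A (hs (Nat.le_succ k)) (hk k hkn)

lemma lineIntegral_refl (A : OneForm M) (x : M) : lineIntegral A (Path.refl x) = 0 := by
  unfold lineIntegral
  have : ∀ t, integrand A (Path.refl x).extend t = 0 := by
    intro t
    rw [Path.refl_extend]
    unfold integrand
    change A x (mfderiv 𝓘(ℝ, ℝ) (𝓡 3) (fun _ => x) t (1 : ℝ)) = 0
    rw [mfderiv_const]
    exact map_zero (A x)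
  rw [intervalIntegral.integral_congr fun t _ => this t]
  simp

lemma lineIntegral_symm (A : OneForm M) {x y : M} (γ : Path x y) :
    lineIntegral A γ.symm = - lineIntegral A γ := by
  unfold lineIntegral
  have : ∀ t, integrand A γ.symm.extend t = -integrand A γ.extend (1 - t) := by
    intro t
    have h := integrand_comp_affine A γ.extend (a := -1) (by norm_num) 1 t
    have e : (fun u => γ.extend (-1 * u + 1)) = γ.symm.extend := by
      rw [Path.extend_symm]
      ext u; congr 1; ring
    rw [e] at h
    rw [h, show (-1 : ℝ) * t + 1 = 1 - t by ring]
    ring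
  rw [intervalIntegral.integral_congr fun t _ => this t, intervalIntegral.integral_neg]
  rw [intervalIntegral.integral_comp_sub_left]
  simp

lemma lineIntegral_trans (A : OneForm M) {x y z : M} {γ : Path x y} {γ' : Path y z}
    (h : IsPiecewiseC1 γ) (h' : IsPiecewiseC1 γ') :
    lineIntegral A (γ.trans γ') = lineIntegral A γ + lineIntegral A γ' := by
  have hi := (h.trans h').intervalIntegrable A
  unfold lineIntegral
  have m1 : uIcc (0 : ℝ) (1 / 2) ⊆ uIcc 0 1 := by
    rw [uIcc_of_le (by norm_num), uIcc_of_le (by norm_num)]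
    exact Icc_subset_Icc le_rfl (by norm_num)
  have m2 : uIcc (1 / 2 : ℝ) 1 ⊆ uIcc 0 1 := by
    rw [uIcc_of_le (by norm_num), uIcc_of_le (by norm_num)]
    exact Icc_subset_Icc (by norm_num) le_rfl
  rw [← intervalIntegral.integral_add_adjacent_intervals (hi.mono_set m1) (hi.mono_set m2)]
  congr 1
  · have e : EqOn (integrand A (γ.trans γ').extend)
        (fun t => 2 * integrand A γ.extend (2 * t)) (uIoo 0 (1 / 2)) := by
      intro t ht
      rw [uIoo_of_le (by norm_num)] at ht
      have h := integrand_comp_affine A γ.extend (a := 2) (by norm_num) 0 t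
      simp only [add_zero] at h
      dsimp only
      rw [← h]
      apply integrand_congr
      filter_upwards [Iio_mem_nhds ht.2] with u hu
      exact Path.extend_trans_of_le_half _ _ (le_of_lt hu)
    rw [intervalIntegral.integral_congr_uIoo e, intervalIntegral.integral_const_mul,
      intervalIntegral.integral_comp_mul_left _ (by norm_num)]
    simp
  · have e : EqOn (integrand A (γ.trans γ').extend)
        (fun t => 2 * integrand A γ'.extend (2 * t - 1)) (uIoo (1 / 2) 1) := by
      intro t ht
      rw [uIoo_of_le (by norm_num)] at ht
      have h := integrand_comp_affine A γ'.extend (a := 2) (by norm_num) (-1) t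
      simp only [← sub_eq_add_neg] at h
      dsimp only
      rw [← h]
      apply integrand_congr
      filter_upwards [Ioi_mem_nhds ht.1] with u hu
      exact Path.extend_trans_of_half_le _ _ (le_of_lt hu)
    rw [intervalIntegral.integral_congr_uIoo e, intervalIntegral.integral_const_mul,
      intervalIntegral.integral_comp_mul_sub _ (by norm_num)]
    norm_num
    ring

end Geometry

/-! ### Based loops, holonomies and hoops -/

/-- Continuous, piecewise `C¹` loops in `M` based at `x₀`. -/
structure Loop (M : Type*) [TopologicalSpace M] [ChartedSpace (EuclideanSpace ℝ (Fin 3)) M]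
    [IsManifold (𝓡 3) ∞ M] (x₀ : M) where
  /-- the underlying continuous loop `[0, 1] → M` -/
  path : Path x₀ x₀
  piecewiseC1 : IsPiecewiseC1 path

section Holonomy

variable {M : Type*} [TopologicalSpace M] [ChartedSpace (EuclideanSpace ℝ (Fin 3)) M]
  [IsManifold (𝓡 3) ∞ M]

namespace Loop

variable {x₀ : M}

/-- The constant loop. -/
def const (x₀ : M) : Loop M x₀ := ⟨Path.refl x₀, .refl x₀⟩

/-- Composition of loops: first `α`, then `β`. -/
def comp (α β : Loop M x₀) : Loop M x₀ := ⟨α.path.trans β.path, α.piecewiseC1.trans β.piecewiseC1⟩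

/-- The reversed loop. -/
def inv (α : Loop M x₀) : Loop M x₀ := ⟨α.path.symm, α.piecewiseC1.symm⟩

end Loop

/-- The holonomy `H(α, A) = exp(i ∮_α A) ∈ U(1)`. -/
def holonomy {x₀ : M} (α : Loop M x₀) (A : OneForm M) : Circle :=
  Circle.exp (lineIntegral A α.path)

lemma holonomy_const (x₀ : M) (A : OneForm M) : holonomy (Loop.const x₀) A = 1 := by
  simp [holonomy, Loop.const, lineIntegral_refl]

lemma holonomy_comp {x₀ : M} (α β : Loop M x₀) (A : OneForm M) :
    holonomy (α.comp β) A = holonomy α A * holonomy β A := by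
  simp [holonomy, Loop.comp, lineIntegral_trans A α.piecewiseC1 β.piecewiseC1, Circle.exp_add]

lemma holonomy_inv {x₀ : M} (α : Loop M x₀) (A : OneForm M) :
    holonomy α.inv A = (holonomy α A)⁻¹ := by
  simp [holonomy, Loop.inv, lineIntegral_symm, Circle.exp_neg]

/-- Two based loops are holonomically equivalent iff all holonomies around them agree. -/
def holonomicSetoid (M : Type*) [TopologicalSpace M] [ChartedSpace (EuclideanSpace ℝ (Fin 3)) M]
    [IsManifold (𝓡 3) ∞ M] (x₀ : M) : Setoid (Loop M x₀) where
  r α β := ∀ A : OneForm M, holonomy α A = holonomy β A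
  iseqv := ⟨fun _ _ => rfl, fun h A => (h A).symm, fun h h' A => (h A).trans (h' A)⟩

/-- Hoops: holonomic equivalence classes of based loops. -/
def Hoop (M : Type*) [TopologicalSpace M] [ChartedSpace (EuclideanSpace ℝ (Fin 3)) M]
    [IsManifold (𝓡 3) ∞ M] (x₀ : M) : Type _ :=
  Quotient (holonomicSetoid M x₀)

/-- The hoop to which a loop belongs. -/
def Loop.toHoop {x₀ : M} (α : Loop M x₀) : Hoop M x₀ := Quotient.mk _ α

/-- The trivial hoop: the class of the constant loop. -/
def Hoop.trivial (x₀ : M) : Hoop M x₀ := (Loop.const x₀).toHoop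

open Classical in
/-- The loop functional `Γ`, equal to `1` on loops in the trivial hoop and to `0` otherwise. -/
def loopFunctional {x₀ : M} (α : Loop M x₀) : ℂ :=
  if α.toHoop = Hoop.trivial x₀ then 1 else 0

/-! ### The holonomy algebra and its completion -/

/-- The C*-algebra of all bounded complex functions on the space of connections, with pointwise
operations and the sup norm. -/
abbrev BoundedFunctions (M : Type*) [TopologicalSpace M]
    [ChartedSpace (EuclideanSpace ℝ (Fin 3)) M] [IsManifold (𝓡 3) ∞ M] : Type _ :=
  lp (fun _ : OneForm M => ℂ) ∞

/-- The bounded function `A ↦ H(α, A)` on the space of connections. -/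
def holonomyFunction {x₀ : M} (α : Loop M x₀) : BoundedFunctions M :=
  ⟨fun A => (holonomy α A : ℂ), memℓp_infty ⟨1, by rintro _ ⟨A, rfl⟩; exact (Circle.norm_coe _).le⟩⟩

lemma holonomyFunction_const (x₀ : M) : holonomyFunction (Loop.const x₀) = 1 := by
  ext A
  simp [holonomyFunction, holonomy_const]

lemma holonomyFunction_comp {x₀ : M} (α β : Loop M x₀) :
    holonomyFunction (α.comp β) = holonomyFunction α * holonomyFunction β := by
  ext A
  simp [holonomyFunction, holonomy_comp]

lemma holonomyFunction_inv {x₀ : M} (α : Loop M x₀) :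
    holonomyFunction α.inv = star (holonomyFunction α) := by
  ext A
  change (holonomy α.inv A : ℂ) = (starRingEnd ℂ) (holonomy α A : ℂ)
  rw [holonomy_inv, Circle.coe_inv_eq_conj]

/-- The holonomy `*`-algebra: the complex linear span of the functions `A ↦ H(α, A)`. -/
def holonomyAlgebra (M : Type*) [TopologicalSpace M] [ChartedSpace (EuclideanSpace ℝ (Fin 3)) M]
    [IsManifold (𝓡 3) ∞ M] (x₀ : M) : StarSubalgebra ℂ (BoundedFunctions M) where
  carrier := Submodule.span ℂ (range (holonomyFunction : Loop M x₀ → BoundedFunctions M))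
  zero_mem' := Submodule.zero_mem _
  add_mem' := Submodule.add_mem _
  mul_mem' {f g} hf hg := by
    have h := Submodule.mul_mem_mul hf hg
    rw [Submodule.span_mul_span] at h
    refine Submodule.span_mono ?_ h
    rintro _ ⟨_, ⟨α, rfl⟩, _, ⟨β, rfl⟩, rfl⟩
    exact ⟨α.comp β, holonomyFunction_comp α β⟩
  algebraMap_mem' c := by
    rw [Algebra.algebraMap_eq_smul_one, ← holonomyFunction_const x₀]
    exact Submodule.smul_mem _ _ (Submodule.subset_span ⟨_, rfl⟩)
  star_mem' {f} hf := by
    induction hf using Submodule.span_induction with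
    | mem f h =>
      obtain ⟨α, rfl⟩ := h
      exact Submodule.subset_span ⟨α.inv, holonomyFunction_inv α⟩
    | zero => simp
    | add f g _ _ hf hg =>
      rw [star_add]
      exact Submodule.add_mem _ hf hg
    | smul c f _ hf =>
      rw [star_smul]
      exact Submodule.smul_mem _ _ hf

/-- The `U(1)` holonomy C*-algebra: the completion of the holonomy algebra in the sup norm,
realised as its closure in the complete space of all bounded functions on the connections. -/
def HolonomyCStarAlgebra (M : Type*) [TopologicalSpace M]
    [ChartedSpace (EuclideanSpace ℝ (Fin 3)) M] [IsManifold (𝓡 3) ∞ M] (x₀ : M) : Type _ :=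
  (holonomyAlgebra M x₀).topologicalClosure

/-- The pointwise operations and the sup norm make it a commutative unital C*-algebra. -/
instance (x₀ : M) : CommCStarAlgebra (HolonomyCStarAlgebra M x₀) :=
  haveI : IsClosed ((holonomyAlgebra M x₀).topologicalClosure : Set (BoundedFunctions M)) :=
    (holonomyAlgebra M x₀).isClosed_topologicalClosure
  StarSubalgebra.commCStarAlgebra (holonomyAlgebra M x₀).topologicalClosure

/-- The elements of the holonomy C*-algebra are bounded functions of the connection. -/
instance (x₀ : M) : CoeFun (HolonomyCStarAlgebra M x₀) (fun _ => OneForm M → ℂ) :=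
  ⟨fun f => f.1⟩

/-- The generator of the holonomy C*-algebra given by the loop `α`. -/
def generator {x₀ : M} (α : Loop M x₀) : HolonomyCStarAlgebra M x₀ :=
  ⟨holonomyFunction α, (holonomyAlgebra M x₀).le_topologicalClosure
    (Submodule.subset_span ⟨α, rfl⟩)⟩

/-- The Gelfand spectrum of the holonomy C*-algebra. -/
abbrev Spectrum (M : Type*) [TopologicalSpace M] [ChartedSpace (EuclideanSpace ℝ (Fin 3)) M]
    [IsManifold (𝓡 3) ∞ M] (x₀ : M) : Type _ :=
  WeakDual.characterSpace ℂ (HolonomyCStarAlgebra M x₀)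

/-- The spectrum carries its Borel `σ`-algebra. -/
instance (x₀ : M) : MeasurableSpace (Spectrum M x₀) := borel _

instance (x₀ : M) : BorelSpace (Spectrum M x₀) := ⟨rfl⟩

/-- `Φ` is the automorphism of the holonomy C*-algebra induced by the diffeomorphism `φ`, i.e.
`(Φ f)(A) = f(φ^*A)` for all `f` in the algebra and all connections `A`. -/
def IsInducedBy {x₀ : M} (Φ : HolonomyCStarAlgebra M x₀ ≃⋆ₐ[ℂ] HolonomyCStarAlgebra M x₀)
    (φ : M ≃ₘ^∞⟮𝓡 3, 𝓡 3⟯ M) : Prop :=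
  ∀ (f : HolonomyCStarAlgebra M x₀) (A : OneForm M),
    Φ f A = f (A.pullback φ)

/-- The map `χ ↦ χ ∘ Φ` of the spectrum induced by an automorphism `Φ` of the algebra. -/
def spectrumMap {x₀ : M} (Φ : HolonomyCStarAlgebra M x₀ ≃⋆ₐ[ℂ] HolonomyCStarAlgebra M x₀) :
    C(Spectrum M x₀, Spectrum M x₀) :=
  WeakDual.CharacterSpace.compContinuousMap
    (Φ : HolonomyCStarAlgebra M x₀ →⋆ₐ[ℂ] HolonomyCStarAlgebra M x₀)

end Holonomy

end

end U1Holonomy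

/-! A line integral is real-linear in the connection, so each function `A ↦ H(α, A)` is a character
of the additive group of one-forms. Elements of the algebra are therefore uniform limits of
trigonometric polynomials, that is, almost periodic functions, and `Λ` is their mean value.

Existence amounts to the bound `‖∑ c α * Γ α‖ ≤ ‖∑ c α • T α‖` (`norm_sum_loopFunctional_le`). Some
connection `A` makes every non-trivial hoop in the finite sum have holonomy different from `1`;
averaging the polynomial over `0, A, …, (N - 1) • A` does not exceed its sup norm, and as `N → ∞` it
kills exactly the non-trivial hoops. Since the generators span a dense subspace, uniqueness,
compatibility with `star` and invariance need only be checked on them (`ext_of_generator`).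

Positivity follows from `Λ 1 = 1` and `‖Λ‖ ≤ 1`. For strictness (`functional_pos`), almost
periodicity gives finitely many translates of `|f|²` whose sum is bounded below by a positive
constant, while `Λ` is translation invariant. The measure comes from Gelfand duality and the Riesz
representation theorem, and inherits faithfulness and invariance from `Λ`. -/

namespace U1Holonomy

noncomputable section

section LineIntegrals

set_option linter.unusedSectionVars false

variable {M : Type*} [TopologicalSpace M] [ChartedSpace (EuclideanSpace ℝ (Fin 3)) M]
  [IsManifold (𝓡 3) ∞ M]

/-! ### Line integrals as linear functionals of the connection -/

lemma integrand_add (A B : OneForm M) (γ : ℝ → M) (t : ℝ) :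
    integrand (A + B) γ t = integrand A γ t + integrand B γ t := by
  unfold integrand
  rw [ContMDiffSection.coe_add]
  rfl

lemma integrand_smul (c : ℝ) (A : OneForm M) (γ : ℝ → M) (t : ℝ) :
    integrand (c • A) γ t = c * integrand A γ t := by
  unfold integrand
  rw [ContMDiffSection.coe_smul]
  rfl

/-- The line integral along a loop as a linear functional on the space of connections. -/
def Loop.period {x₀ : M} (α : Loop M x₀) : Module.Dual ℝ (OneForm M) where
  toFun A := lineIntegral A α.path
  map_add' A B := by
    unfold lineIntegral
    rw [← intervalIntegral.integral_add (α.piecewiseC1.intervalIntegrable A)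
      (α.piecewiseC1.intervalIntegrable B)]
    exact intervalIntegral.integral_congr fun t _ => integrand_add A B _ t
  map_smul' c A := by
    unfold lineIntegral
    rw [RingHom.id_apply, smul_eq_mul, ← intervalIntegral.integral_const_mul]
    exact intervalIntegral.integral_congr fun t _ => integrand_smul c A _ t

lemma holonomy_eq_exp_period {x₀ : M} (α : Loop M x₀) (A : OneForm M) :
    holonomy α A = Circle.exp (α.period A) := rfl

lemma holonomy_add {x₀ : M} (α : Loop M x₀) (A B : OneForm M) :
    holonomy α (A + B) = holonomy α A * holonomy α B := by
  simp [holonomy_eq_exp_period, Circle.exp_add]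

lemma holonomy_zero {x₀ : M} (α : Loop M x₀) : holonomy α 0 = 1 := by
  simp [holonomy_eq_exp_period]

lemma holonomy_nsmul {x₀ : M} (α : Loop M x₀) (n : ℕ) (A : OneForm M) :
    holonomy α (n • A) = holonomy α A ^ n := by
  induction n with
  | zero => simp [holonomy_zero]
  | succ n ih => rw [succ_nsmul, holonomy_add, ih, pow_succ]

/-! ### Action of diffeomorphisms on paths and line integrals -/

lemma IsPiecewiseC1.map (φ : M ≃ₘ^∞⟮𝓡 3, 𝓡 3⟯ M) {x y : M} {γ : Path x y}
    (h : IsPiecewiseC1 γ) : IsPiecewiseC1 (γ.map φ.continuous) := by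
  obtain ⟨n, s, hs, h0, h1, hk⟩ := h
  exact ⟨n, s, hs, h0, h1, fun k hkn =>
    (φ.contMDiff.of_le (by exact_mod_cast le_top)).comp_contMDiffOn (hk k hkn)⟩

lemma integrand_comp_diffeomorph (φ : M ≃ₘ^∞⟮𝓡 3, 𝓡 3⟯ M) (A : OneForm M) (γ : ℝ → M) (t : ℝ) :
    integrand A (φ ∘ γ) t = integrand (A.pullback φ) γ t := by
  have hφ := φ.mdifferentiable (by simp)
  have hφ' := φ.symm.mdifferentiable (by simp)
  by_cases hd : MDifferentiableAt 𝓘(ℝ, ℝ) (𝓡 3) γ t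
  · unfold integrand
    rw [mfderiv_comp t (hφ (γ t)) hd]
    rfl
  -- Composing with `φ.symm` shows that `φ ∘ γ` is differentiable only where `γ` is; elsewhere both
  -- derivatives take the default value `0`.
  · have hd' : ¬ MDifferentiableAt 𝓘(ℝ, ℝ) (𝓡 3) (φ ∘ γ) t := by
      intro h
      apply hd
      have := MDifferentiableAt.comp t (hφ' (φ (γ t))) h
      convert this using 1
      ext u
      simp
    unfold integrand
    rw [mfderiv_zero_of_not_mdifferentiableAt hd, mfderiv_zero_of_not_mdifferentiableAt hd']
    exact (map_zero (A (φ (γ t)))).trans (map_zero (A.pullback φ (γ t))).symm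

lemma lineIntegral_map (φ : M ≃ₘ^∞⟮𝓡 3, 𝓡 3⟯ M) (A : OneForm M) {x y : M} (γ : Path x y) :
    lineIntegral A (γ.map φ.continuous) = lineIntegral (A.pullback φ) γ :=
  intervalIntegral.integral_congr fun t _ => integrand_comp_diffeomorph φ A γ.extend t

lemma OneForm.pullback_pullback_symm (φ : M ≃ₘ^∞⟮𝓡 3, 𝓡 3⟯ M) (A : OneForm M) :
    (A.pullback φ).pullback φ.symm = A := by
  refine ContMDiffSection.ext fun x => ?_
  have hφ := φ.mdifferentiable (by simp)
  have hφ' := φ.symm.mdifferentiable (by simp)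
  have h := mfderiv_comp x (hφ (φ.symm x)) (hφ' x)
  have e : φ ∘ φ.symm = id := funext φ.apply_symm_apply
  rw [e, mfderiv_id] at h
  change (A (φ (φ.symm x))).comp ((mfderiv (𝓡 3) (𝓡 3) φ (φ.symm x)).comp
    (mfderiv (𝓡 3) (𝓡 3) φ.symm x)) = A x
  rw [← h]
  change A (φ (φ.symm x)) = A x
  rw [φ.apply_symm_apply]

lemma OneForm.pullback_symm_pullback (φ : M ≃ₘ^∞⟮𝓡 3, 𝓡 3⟯ M) (A : OneForm M) :
    (A.pullback φ.symm).pullback φ = A :=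
  OneForm.pullback_pullback_symm φ.symm A

/-! ### Connected manifolds are connected by piecewise `C¹` paths -/

lemma exists_isPiecewiseC1_of_segment_subset (x : M) {y z : M}
    (hy : y ∈ (chartAt (EuclideanSpace ℝ (Fin 3)) x).source)
    (hz : z ∈ (chartAt (EuclideanSpace ℝ (Fin 3)) x).source)
    (hseg : segment ℝ (chartAt (EuclideanSpace ℝ (Fin 3)) x y)
      (chartAt (EuclideanSpace ℝ (Fin 3)) x z) ⊆ (chartAt (EuclideanSpace ℝ (Fin 3)) x).target) :
    ∃ γ : Path y z, IsPiecewiseC1 γ := by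
  set e := chartAt (EuclideanSpace ℝ (Fin 3)) x with he
  let l : ℝ → EuclideanSpace ℝ (Fin 3) := fun t => AffineMap.lineMap (e y) (e z) t
  have hl : ContDiff ℝ 1 l := by
    simp only [l, AffineMap.lineMap_apply_module]
    fun_prop
  have hmem : ∀ t ∈ Icc (0 : ℝ) 1, l t ∈ e.target := fun t ht =>
    hseg (segment_eq_image_lineMap ℝ (e y) (e z) ▸ mem_image_of_mem _ ht)
  let γ : Path y z :=
    { toFun := fun t => e.symm (l t)
      continuous_toFun := e.continuousOn_symm.comp_continuous
        (hl.continuous.comp continuous_subtype_val) fun t => hmem t t.2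
      source' := by simp [l, e.left_inv hy]
      target' := by simp [l, e.left_inv hz] }
  refine ⟨γ, 1, fun k => min k 1, ?_, by simp, by simp, fun k hk => ?_⟩
  · intro a b h
    exact min_le_min_right 1 (Nat.cast_le.2 h)
  · obtain rfl : k = 0 := by omega
    simp only [CharP.cast_eq_zero, zero_add, Nat.cast_one, zero_le_one, inf_of_le_left, le_refl]
    refine ContMDiffOn.congr (((contMDiffOn_chart_symm (I := 𝓡 3) (n := ∞) (x := x)).of_le
      (by exact_mod_cast le_top)).comp hl.contMDiff.contMDiffOn hmem) ?_
    intro t ht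
    exact γ.extend_apply ht

/-- Being joined by such a path is transitive, and holds locally in both directions by straight
segments in a chart ball. Needed because a diffeomorphism may move the base point. -/
lemma exists_isPiecewiseC1 [ConnectedSpace M] (x y : M) : ∃ γ : Path x y, IsPiecewiseC1 γ := by
  refine PreconnectedSpace.induction₂' (fun x y : M => ∃ γ : Path x y, IsPiecewiseC1 γ)
    (fun x => ?_) ⟨?_⟩ x y
  · set e := chartAt (EuclideanSpace ℝ (Fin 3)) x with he
    obtain ⟨r, hr, hball⟩ := Metric.isOpen_iff.1 e.open_target (e x) (mem_chart_target _ x)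
    have h1 : ∀ᶠ y in 𝓝 x, y ∈ e.source := chart_source_mem_nhds _ x
    have h2 : ∀ᶠ y in 𝓝 x, e y ∈ Metric.ball (e x) r :=
      (e.continuousAt (mem_chart_source _ x)).eventually (Metric.ball_mem_nhds _ hr)
    filter_upwards [h1, h2] with y hy1 hy2
    obtain ⟨γ, hγ⟩ := exists_isPiecewiseC1_of_segment_subset x (mem_chart_source _ x) hy1
      (((convex_ball (e x) r).segment_subset (Metric.mem_ball_self hr) hy2).trans hball)
    exact ⟨⟨γ, hγ⟩, γ.symm, hγ.symm⟩
  · rintro x y z ⟨γ, hγ⟩ ⟨γ', hγ'⟩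
    exact ⟨γ.trans γ', hγ.trans hγ'⟩

/-- The image of a based loop under a diffeomorphism, brought back to the base point along `η`. -/
def Loop.transport {x₀ : M} (φ : M ≃ₘ^∞⟮𝓡 3, 𝓡 3⟯ M) (η : Path x₀ (φ x₀)) (hη : IsPiecewiseC1 η)
    (α : Loop M x₀) : Loop M x₀ :=
  ⟨(η.trans (α.path.map φ.continuous)).trans η.symm, (hη.trans (α.piecewiseC1.map φ)).trans hη.symm⟩

/-- As `U(1)` is abelian, the contributions of `η` and its reverse cancel. -/
lemma holonomy_transport {x₀ : M} (φ : M ≃ₘ^∞⟮𝓡 3, 𝓡 3⟯ M) (η : Path x₀ (φ x₀))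
    (hη : IsPiecewiseC1 η) (α : Loop M x₀) (A : OneForm M) :
    holonomy (α.transport φ η hη) A = holonomy α (A.pullback φ) := by
  have h := α.piecewiseC1.map φ
  unfold holonomy Loop.transport
  rw [lineIntegral_trans A (hη.trans h) hη.symm, lineIntegral_trans A hη h, lineIntegral_symm,
    lineIntegral_map]
  congr 1
  ring

/-! ### Values of the loop functional and their diffeomorphism invariance. -/

lemma loopFunctional_eq_one {x₀ : M} {α : Loop M x₀} (h : ∀ A, holonomy α A = 1) :
    loopFunctional α = 1 :=
  if_pos (Quotient.sound fun A => (h A).trans (holonomy_const x₀ A).symm)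

lemma loopFunctional_eq_zero {x₀ : M} {α : Loop M x₀} (h : ¬ ∀ A, holonomy α A = 1) :
    loopFunctional α = 0 :=
  if_neg fun h' => h fun A => (Quotient.exact h' A).trans (holonomy_const x₀ A)

lemma loopFunctional_transport {x₀ : M} (φ : M ≃ₘ^∞⟮𝓡 3, 𝓡 3⟯ M) (η : Path x₀ (φ x₀))
    (hη : IsPiecewiseC1 η) (α : Loop M x₀) :
    loopFunctional (α.transport φ η hη) = loopFunctional α := by
  by_cases h : ∀ A, holonomy α A = 1
  · rw [loopFunctional_eq_one h,
      loopFunctional_eq_one fun A => (holonomy_transport φ η hη α A).trans (h _)]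
  · rw [loopFunctional_eq_zero h, loopFunctional_eq_zero fun h' => h fun A => ?_]
    rw [← OneForm.pullback_symm_pullback φ A, ← holonomy_transport φ η hη]
    exact h' _

end LineIntegrals

/-- A functional on `V` dominated by the norm of the image under `T : V → E` comes from a
contractive functional on `E`. -/
lemma exists_contraction_of_norm_le {V E : Type*} [AddCommGroup V] [Module ℂ V]
    [NormedAddCommGroup E] [NormedSpace ℂ E] (T : V →ₗ[ℂ] E) (e : V →ₗ[ℂ] ℂ)
    (h : ∀ v, ‖e v‖ ≤ ‖T v‖) :
    ∃ Λ : E →L[ℂ] ℂ, (∀ v, Λ (T v) = e v) ∧ ∀ f, ‖Λ f‖ ≤ ‖f‖ := by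
  -- The bound makes `e` vanish on `ker T`, so `e = g ∘ T` with `g` linear but possibly
  -- discontinuous on `E`. On the range of `T` it is a contraction, and Hahn–Banach extends that
  -- restriction.
  have hker : e ∈ (LinearMap.ker T).dualAnnihilator := by
    rw [Submodule.mem_dualAnnihilator]
    intro v hv
    have := h v
    rwa [LinearMap.mem_ker.1 hv, norm_zero, norm_le_zero_iff] at this
  rw [← LinearMap.range_dualMap_eq_dualAnnihilator_ker] at hker
  obtain ⟨g, rfl⟩ := hker
  have hb : ∀ f : LinearMap.range T, ‖g.domRestrict (LinearMap.range T) f‖ ≤ 1 * ‖f‖ := by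
    rintro ⟨_, v, rfl⟩
    rw [one_mul]
    exact h v
  obtain ⟨Λ, hΛ, hnorm⟩ := exists_extension_norm_eq (LinearMap.range T)
    (LinearMap.mkContinuous (g.domRestrict (LinearMap.range T)) 1 hb)
  refine ⟨Λ, fun v => hΛ ⟨T v, LinearMap.mem_range_self T v⟩, fun f => ?_⟩
  exact (Λ.le_opNorm f).trans (mul_le_of_le_one_left (norm_nonneg f)
    (hnorm.trans_le (LinearMap.mkContinuous_norm_le _ zero_le_one _)))

section Functional

variable {M : Type*} [TopologicalSpace M] [ChartedSpace (EuclideanSpace ℝ (Fin 3)) M]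
  [IsManifold (𝓡 3) ∞ M] {x₀ : M}

/-! ### The holonomy algebra as an algebra of functions -/

/-- Evaluation at the connection `A`, as a character of the holonomy algebra. -/
def evalAt (A : OneForm M) : HolonomyCStarAlgebra M x₀ →⋆ₐ[ℂ] ℂ where
  toFun f := f A
  map_one' := rfl
  map_mul' _ _ := rfl
  map_zero' := rfl
  map_add' _ _ := rfl
  commutes' _ := rfl
  map_star' _ := rfl

lemma evalAt_generator (A : OneForm M) (α : Loop M x₀) :
    evalAt A (generator α) = (holonomy α A : ℂ) := rfl

lemma ext_evalAt {f g : HolonomyCStarAlgebra M x₀} (h : ∀ A, evalAt A f = evalAt A g) : f = g :=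
  Subtype.ext (lp.ext (funext h))

lemma norm_evalAt_le (A : OneForm M) (f : HolonomyCStarAlgebra M x₀) : ‖evalAt A f‖ ≤ ‖f‖ :=
  lp.norm_apply_le_norm ENNReal.top_ne_zero f.1 A

lemma norm_le_of_forall_evalAt_le {f : HolonomyCStarAlgebra M x₀} {C : ℝ}
    (h : ∀ A, ‖evalAt A f‖ ≤ C) : ‖f‖ ≤ C :=
  lp.norm_le_of_forall_le' C h

lemma generator_const : generator (Loop.const x₀) = 1 :=
  ext_evalAt fun A => by simp [evalAt_generator, holonomy_const]

lemma star_generator (α : Loop M x₀) : star (generator α) = generator α.inv :=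
  ext_evalAt fun A => by
    rw [map_star, evalAt_generator, evalAt_generator, holonomy_inv, Circle.coe_inv_eq_conj]
    rfl

/-- The linear combination of generators with the given coefficients. -/
def trigPolynomial : (Loop M x₀ →₀ ℂ) →ₗ[ℂ] HolonomyCStarAlgebra M x₀ :=
  Finsupp.linearCombination ℂ generator

lemma trigPolynomial_single (α : Loop M x₀) (c : ℂ) :
    trigPolynomial (Finsupp.single α c) = c • generator α :=
  Finsupp.linearCombination_single ..

lemma evalAt_trigPolynomial (A : OneForm M) (c : Loop M x₀ →₀ ℂ) :
    evalAt A (trigPolynomial c) = ∑ α ∈ c.support, c α * (holonomy α A : ℂ) := by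
  rw [trigPolynomial, Finsupp.linearCombination_apply, Finsupp.sum, map_sum]
  exact Finset.sum_congr rfl fun α _ => by rw [map_smul, evalAt_generator, smul_eq_mul]

lemma denseRange_trigPolynomial :
    DenseRange (trigPolynomial : (Loop M x₀ →₀ ℂ) → HolonomyCStarAlgebra M x₀) := by
  intro f
  refine closure_subtype.2 (closure_mono ?_ f.2)
  intro g hg
  change g ∈ Submodule.span ℂ (range (holonomyFunction : Loop M x₀ → BoundedFunctions M)) at hg
  induction hg using Submodule.span_induction with
  | mem g h =>
    obtain ⟨α, rfl⟩ := h
    exact ⟨generator α, ⟨Finsupp.single α 1, by rw [trigPolynomial_single, one_smul]⟩, rfl⟩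
  | zero => exact ⟨0, ⟨0, map_zero _⟩, rfl⟩
  | add g h _ _ hg hh =>
    obtain ⟨_, ⟨a, rfl⟩, rfl⟩ := hg
    obtain ⟨_, ⟨b, rfl⟩, rfl⟩ := hh
    exact ⟨_, ⟨a + b, rfl⟩, by rw [map_add]; rfl⟩
  | smul z g _ hg =>
    obtain ⟨_, ⟨a, rfl⟩, rfl⟩ := hg
    exact ⟨_, ⟨z • a, rfl⟩, by rw [map_smul]; rfl⟩

lemma ext_of_generator {F G : HolonomyCStarAlgebra M x₀ →L[ℂ] ℂ}
    (h : ∀ α : Loop M x₀, F (generator α) = G (generator α)) : F = G := by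
  have h' : F.toLinearMap ∘ₗ trigPolynomial = G.toLinearMap ∘ₗ trigPolynomial :=
    Finsupp.lhom_ext fun α c => by simp [trigPolynomial_single, h]
  exact ContinuousLinearMap.coeFn_injective (denseRange_trigPolynomial.equalizer F.continuous
    G.continuous (funext fun c => LinearMap.congr_fun h' c))

/-! ### Existence of the functional -/

/-- The geometric sums stay bounded by `2 / ‖z - 1‖`. -/
lemma tendsto_average_pow {z : ℂ} (hz : ‖z‖ = 1) (hz1 : z ≠ 1) :
    Tendsto (fun N : ℕ => (N : ℂ)⁻¹ * ∑ n ∈ Finset.range N, z ^ n) atTop (𝓝 0) := by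
  have hb : ∀ N : ℕ, ‖(N : ℂ)⁻¹ * ∑ n ∈ Finset.range N, z ^ n‖ ≤ (N : ℝ)⁻¹ * (2 / ‖z - 1‖) := by
    intro N
    rw [norm_mul, norm_inv, Complex.norm_natCast, geom_sum_eq hz1, norm_div]
    gcongr
    calc ‖z ^ N - 1‖ ≤ ‖z ^ N‖ + ‖(1 : ℂ)‖ := norm_sub_le _ _
      _ = 2 := by rw [norm_pow, hz, one_pow, norm_one]; norm_num
  refine squeeze_zero_norm hb ?_
  simpa using (tendsto_inv_atTop_nhds_zero_nat (𝕜 := ℝ)).mul_const (2 / ‖z - 1‖)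

lemma exists_period_ne_zero {α : Loop M x₀} (h : ¬ ∀ A, holonomy α A = 1) :
    ∃ A, α.period A ≠ 0 := by
  by_contra! h'
  exact h fun A => by rw [holonomy_eq_exp_period, h', Circle.exp_zero]

/-- Finitely many non-trivial holonomies are simultaneously non-trivial at some connection. -/
lemma exists_forall_holonomy_ne_one (S : Finset (Loop M x₀))
    (hS : ∀ α ∈ S, ¬ ∀ A, holonomy α A = 1) : ∃ A : OneForm M, ∀ α ∈ S, holonomy α A ≠ 1 := by
  -- A real vector space is not a finite union of proper subspaces, here the kernels of the periods.
  obtain ⟨A, hA⟩ := Module.Dual.exists_forall_ne_zero_of_forall_exists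
    (fun α : S => (α : Loop M x₀).period) fun α => exists_period_ne_zero (hS α α.2)
  -- Non-zero periods could still lie in `2πℤ`; scaling by a small `s > 0` brings them into `(-π,
  -- π)`, where only `0` has exponential `1`.
  have key : ∀ α ∈ S, ∀ᶠ s : ℝ in 𝓝[>] 0, holonomy α (s • A) ≠ 1 := by
    intro α hα
    have h1 : Tendsto (fun s : ℝ => s * α.period A) (𝓝[>] 0) (𝓝 0) := by
      have : Continuous fun s : ℝ => s * α.period A := by fun_prop
      simpa using (this.tendsto 0).mono_left nhdsWithin_le_nhds
    filter_upwards [h1.eventually (Ioo_mem_nhds (neg_lt_zero.2 Real.pi_pos) Real.pi_pos),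
      self_mem_nhdsWithin] with s hs hs0 h
    rw [holonomy_eq_exp_period, map_smul, smul_eq_mul, ← Circle.arg_eq_zero,
      Circle.arg_exp hs.1 hs.2.le] at h
    exact mul_ne_zero (ne_of_gt hs0) (hA ⟨α, hα⟩) h
  obtain ⟨s, hs⟩ := ((Filter.eventually_all_finset S).2 key).exists
  exact ⟨s • A, hs⟩

/-- Since `holonomy α (n • A) = holonomy α A ^ n`, averaging over `n` turns each character into an
average of powers, which tends to `1` or `0` according to whether the hoop is trivial. -/
lemma norm_sum_loopFunctional_le (c : Loop M x₀ →₀ ℂ) :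
    ‖Finsupp.linearCombination ℂ loopFunctional c‖ ≤ ‖trigPolynomial c‖ := by
  classical
  obtain ⟨A, hA⟩ := exists_forall_holonomy_ne_one (c.support.filter fun α => ¬ ∀ A, holonomy α A = 1)
    fun α hα => (Finset.mem_filter.1 hα).2
  have hlim : Tendsto (fun N : ℕ => (N : ℂ)⁻¹ * ∑ n ∈ Finset.range N,
      evalAt (n • A) (trigPolynomial c)) atTop
      (𝓝 (Finsupp.linearCombination ℂ loopFunctional c)) := by
    simp only [evalAt_trigPolynomial, Finsupp.linearCombination_apply, Finsupp.sum]
    have e : ∀ N : ℕ, (N : ℂ)⁻¹ * ∑ n ∈ Finset.range N, ∑ α ∈ c.support,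
        c α * (holonomy α (n • A) : ℂ) = ∑ α ∈ c.support, c α *
          ((N : ℂ)⁻¹ * ∑ n ∈ Finset.range N, (holonomy α A : ℂ) ^ n) := by
      intro N
      rw [Finset.sum_comm, Finset.mul_sum]
      refine Finset.sum_congr rfl fun α _ => ?_
      simp only [holonomy_nsmul, Circle.coe_pow, ← Finset.mul_sum]
      ring
    simp only [e, smul_eq_mul]
    refine tendsto_finsetSum _ fun α hα => Tendsto.const_mul _ ?_
    by_cases h : ∀ A, holonomy α A = 1
    · rw [loopFunctional_eq_one h, h A]
      refine tendsto_const_nhds.congr' ?_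
      filter_upwards [eventually_ne_atTop 0] with N hN
      have : (N : ℂ) ≠ 0 := Nat.cast_ne_zero.2 hN
      simp [this]
    · rw [loopFunctional_eq_zero h]
      refine tendsto_average_pow (Circle.norm_coe _) fun h1 => ?_
      exact hA α (Finset.mem_filter.2 ⟨hα, h⟩) (Circle.ext h1)
  refine le_of_tendsto hlim.norm ?_
  filter_upwards [eventually_ne_atTop 0] with N hN
  have hN' : (0 : ℝ) < N := Nat.cast_pos.2 (Nat.pos_of_ne_zero hN)
  rw [norm_mul, norm_inv, Complex.norm_natCast, inv_mul_le_iff₀ hN']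
  refine (norm_sum_le_of_le _ fun n _ => norm_evalAt_le _ _).trans ?_
  simp

/-- The continuous linear functional extending the loop functional; it is a contraction. -/
lemma exists_functional : ∃ Λ : HolonomyCStarAlgebra M x₀ →L[ℂ] ℂ,
    (∀ α : Loop M x₀, Λ (generator α) = loopFunctional α) ∧ ∀ f, ‖Λ f‖ ≤ ‖f‖ := by
  obtain ⟨Λ, h, hΛ⟩ := exists_contraction_of_norm_le trigPolynomial
    (Finsupp.linearCombination ℂ loopFunctional) (norm_sum_loopFunctional_le (x₀ := x₀))
  refine ⟨Λ, fun α => ?_, hΛ⟩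
  have h1 : trigPolynomial (Finsupp.single α 1) = generator α := by
    rw [trigPolynomial_single, one_smul]
  have h2 := h (Finsupp.single α 1)
  rw [Finsupp.linearCombination_single, one_smul] at h2
  exact h1 ▸ h2

end Functional

section Precomposition

variable {M : Type*} [TopologicalSpace M] [ChartedSpace (EuclideanSpace ℝ (Fin 3)) M]
  [IsManifold (𝓡 3) ∞ M] {x₀ : M}

/-! ### Endomorphisms induced by maps of the space of connections -/

/-- Precomposition with a map of the space of connections. -/
def BoundedFunctions.precomp (e : OneForm M → OneForm M) :
    BoundedFunctions M →⋆ₐ[ℂ] BoundedFunctions M where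
  toFun f := ⟨fun A => f (e A), memℓp_infty
    ⟨‖f‖, by rintro _ ⟨A, rfl⟩; exact lp.norm_apply_le_norm ENNReal.top_ne_zero f _⟩⟩
  map_one' := rfl
  map_mul' _ _ := rfl
  map_zero' := rfl
  map_add' _ _ := rfl
  commutes' _ := rfl
  map_star' _ := rfl

lemma BoundedFunctions.continuous_precomp (e : OneForm M → OneForm M) :
    Continuous (BoundedFunctions.precomp e) :=
  AddMonoidHomClass.continuous_of_bound _ 1 fun f => by
    rw [one_mul]
    exact lp.norm_le_of_forall_le' _ fun A => lp.norm_apply_le_norm ENNReal.top_ne_zero f (e A)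

/-- The hypothesis covers two cases at once: a translation keeps the loop and produces the constant
`z`, whereas a diffeomorphism changes the loop with `z = 1`. -/
lemma BoundedFunctions.precomp_mem {e : OneForm M → OneForm M}
    (he : ∀ α : Loop M x₀, ∃ (z : ℂ) (β : Loop M x₀), ∀ A,
      (holonomy α (e A) : ℂ) = z * holonomy β A)
    {f : BoundedFunctions M} (hf : f ∈ (holonomyAlgebra M x₀).topologicalClosure) :
    BoundedFunctions.precomp e f ∈ (holonomyAlgebra M x₀).topologicalClosure := by
  refine map_mem_closure (BoundedFunctions.continuous_precomp e) hf ?_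
  intro g hg
  change g ∈ Submodule.span ℂ (range (holonomyFunction : Loop M x₀ → BoundedFunctions M)) at hg
  change _ ∈ Submodule.span ℂ (range (holonomyFunction : Loop M x₀ → BoundedFunctions M))
  induction hg using Submodule.span_induction with
  | mem g h =>
    obtain ⟨α, rfl⟩ := h
    obtain ⟨z, β, h⟩ := he α
    have : BoundedFunctions.precomp e (holonomyFunction α) = z • holonomyFunction β :=
      lp.ext (funext h)
    rw [this]
    exact Submodule.smul_mem _ _ (Submodule.subset_span ⟨β, rfl⟩)
  | zero => rw [map_zero]; exact Submodule.zero_mem _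
  | add g h _ _ hg hh => rw [map_add]; exact Submodule.add_mem _ hg hh
  | smul z g _ hg => rw [map_smul]; exact Submodule.smul_mem _ _ hg

/-- Precomposition with a map of the space of connections that preserves the holonomies up to
constants, as an endomorphism of the holonomy algebra. -/
def precomp (e : OneForm M → OneForm M) (he : ∀ α : Loop M x₀, ∃ (z : ℂ) (β : Loop M x₀), ∀ A,
      (holonomy α (e A) : ℂ) = z * holonomy β A) :
    HolonomyCStarAlgebra M x₀ →⋆ₐ[ℂ] HolonomyCStarAlgebra M x₀ where
  toFun f := ⟨BoundedFunctions.precomp e f.1, BoundedFunctions.precomp_mem he f.2⟩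
  map_one' := rfl
  map_mul' _ _ := rfl
  map_zero' := rfl
  map_add' _ _ := rfl
  commutes' _ := rfl
  map_star' _ := rfl

/-- The action of the translation by `B` on the holonomy algebra. -/
def translate (B : OneForm M) : HolonomyCStarAlgebra M x₀ →⋆ₐ[ℂ] HolonomyCStarAlgebra M x₀ :=
  precomp (fun A => A + B) fun α => ⟨holonomy α B, α, fun A => by
    rw [holonomy_add, Circle.coe_mul, mul_comm]⟩

lemma evalAt_translate (A B : OneForm M) (f : HolonomyCStarAlgebra M x₀) :
    evalAt A (translate B f) = evalAt (A + B) f := rfl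

lemma translate_generator (B : OneForm M) (α : Loop M x₀) :
    translate B (generator α) = (holonomy α B : ℂ) • generator α :=
  ext_evalAt fun A => by
    rw [evalAt_translate, map_smul, evalAt_generator, evalAt_generator, holonomy_add,
      Circle.coe_mul, smul_eq_mul, mul_comm]

/-- The action of a diffeomorphism on the holonomy algebra. -/
def pullbackHom [ConnectedSpace M] (φ : M ≃ₘ^∞⟮𝓡 3, 𝓡 3⟯ M) :
    HolonomyCStarAlgebra M x₀ →⋆ₐ[ℂ] HolonomyCStarAlgebra M x₀ :=
  precomp (OneForm.pullback φ) fun α => by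
    obtain ⟨η, hη⟩ := exists_isPiecewiseC1 x₀ (φ x₀)
    exact ⟨1, α.transport φ η hη, fun A => by rw [holonomy_transport, one_mul]⟩

lemma evalAt_pullbackHom [ConnectedSpace M] (φ : M ≃ₘ^∞⟮𝓡 3, 𝓡 3⟯ M) (A : OneForm M)
    (f : HolonomyCStarAlgebra M x₀) :
    evalAt A (pullbackHom φ f) = evalAt (A.pullback φ) f := rfl

/-- The automorphism of the holonomy algebra induced by a diffeomorphism. -/
def pullbackEquiv [ConnectedSpace M] (φ : M ≃ₘ^∞⟮𝓡 3, 𝓡 3⟯ M) :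
    HolonomyCStarAlgebra M x₀ ≃⋆ₐ[ℂ] HolonomyCStarAlgebra M x₀ :=
  StarAlgEquiv.ofStarAlgHom (pullbackHom φ) (pullbackHom φ.symm)
    (StarAlgHom.ext fun f => ext_evalAt fun A => by
      change evalAt ((A.pullback φ.symm).pullback φ) f = evalAt A f
      rw [OneForm.pullback_symm_pullback])
    (StarAlgHom.ext fun f => ext_evalAt fun A => by
      change evalAt ((A.pullback φ).pullback φ.symm) f = evalAt A f
      rw [OneForm.pullback_pullback_symm])

lemma isInducedBy_pullbackEquiv [ConnectedSpace M] (φ : M ≃ₘ^∞⟮𝓡 3, 𝓡 3⟯ M) :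
    IsInducedBy (x₀ := x₀) (pullbackEquiv φ) φ :=
  fun _ _ => rfl

end Precomposition

lemma continuous_starAlgHom {A B : Type*} [CommCStarAlgebra A] [CommCStarAlgebra B]
    (F : A →⋆ₐ[ℂ] B) : Continuous F :=
  AddMonoidHomClass.continuous_of_bound F 1 fun a => by
    rw [one_mul]
    exact NonUnitalStarAlgHom.norm_apply_le F a

section Positivity

variable {M : Type*} [TopologicalSpace M] [ChartedSpace (EuclideanSpace ℝ (Fin 3)) M]
  [IsManifold (𝓡 3) ∞ M] {x₀ : M}

/-! ### Positivity and faithfulness of the functional -/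

lemma functional_precomp {Λ : HolonomyCStarAlgebra M x₀ →L[ℂ] ℂ}
    (F : HolonomyCStarAlgebra M x₀ →⋆ₐ[ℂ] HolonomyCStarAlgebra M x₀)
    (h : ∀ α : Loop M x₀, Λ (F (generator α)) = Λ (generator α))
    (f : HolonomyCStarAlgebra M x₀) : Λ (F f) = Λ f := by
  let F' : HolonomyCStarAlgebra M x₀ →L[ℂ] HolonomyCStarAlgebra M x₀ :=
    { toFun := F
      map_add' := map_add F
      map_smul' := map_smul F
      cont := continuous_starAlgHom F }
  have h' : Λ.comp F' = Λ := ext_of_generator h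
  exact congrArg (fun L : HolonomyCStarAlgebra M x₀ →L[ℂ] ℂ => L f) h'

/-- Translation by `B` multiplies a generator by `holonomy α B`, which is `1` on trivial hoops and
irrelevant on the others, where `Λ` vanishes. -/
lemma functional_translate {Λ : HolonomyCStarAlgebra M x₀ →L[ℂ] ℂ}
    (hΛ : ∀ α : Loop M x₀, Λ (generator α) = loopFunctional α) (B : OneForm M)
    (f : HolonomyCStarAlgebra M x₀) : Λ (translate B f) = Λ f := by
  refine functional_precomp _ (fun α => ?_) f
  rw [translate_generator, map_smul, hΛ, smul_eq_mul]
  by_cases h : ∀ A, holonomy α A = 1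
  · rw [h B, Circle.coe_one, one_mul]
  · rw [loopFunctional_eq_zero h, mul_zero]

lemma functional_pullbackEquiv [ConnectedSpace M] {Λ : HolonomyCStarAlgebra M x₀ →L[ℂ] ℂ}
    (hΛ : ∀ α : Loop M x₀, Λ (generator α) = loopFunctional α) (φ : M ≃ₘ^∞⟮𝓡 3, 𝓡 3⟯ M)
    (f : HolonomyCStarAlgebra M x₀) : Λ (pullbackEquiv φ f) = Λ f := by
  refine functional_precomp (pullbackHom φ) (fun α => ?_) f
  obtain ⟨η, hη⟩ := exists_isPiecewiseC1 x₀ (φ x₀)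
  have h : pullbackHom φ (generator α) = generator (α.transport φ η hη) :=
    ext_evalAt fun A => by
      rw [evalAt_pullbackHom, evalAt_generator, evalAt_generator, holonomy_transport]
  rw [h, hΛ, hΛ, loopFunctional_transport]

lemma functional_one {Λ : HolonomyCStarAlgebra M x₀ →L[ℂ] ℂ}
    (hΛ : ∀ α : Loop M x₀, Λ (generator α) = loopFunctional α) : Λ 1 = 1 := by
  rw [← generator_const, hΛ, loopFunctional_eq_one (holonomy_const x₀)]

lemma loopFunctional_inv (α : Loop M x₀) :
    loopFunctional α.inv = (starRingEnd ℂ) (loopFunctional α) := by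
  by_cases h : ∀ A, holonomy α A = 1
  · rw [loopFunctional_eq_one h, loopFunctional_eq_one fun A => by rw [holonomy_inv, h, inv_one],
      map_one]
  · rw [loopFunctional_eq_zero h, map_zero, loopFunctional_eq_zero fun h' => h fun A => ?_]
    rw [← inv_inv (holonomy α A), ← holonomy_inv, h' A, inv_one]

lemma functional_star {Λ : HolonomyCStarAlgebra M x₀ →L[ℂ] ℂ}
    (hΛ : ∀ α : Loop M x₀, Λ (generator α) = loopFunctional α) (f : HolonomyCStarAlgebra M x₀) :
    Λ (star f) = (starRingEnd ℂ) (Λ f) := by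
  -- Conjugating twice gives a linear functional again, which has the same values on generators as
  -- `Λ`.
  let Λ' : HolonomyCStarAlgebra M x₀ →L[ℂ] ℂ :=
    { toFun := fun f => (starRingEnd ℂ) (Λ (star f))
      map_add' := fun f g => by rw [star_add, map_add, map_add]
      map_smul' := fun z f => by
        rw [star_smul, map_smul, smul_eq_mul, map_mul, RingHom.id_apply, smul_eq_mul]
        simp
      cont := Complex.continuous_conj.comp (Λ.continuous.comp continuous_star) }
  have h : Λ' = Λ := ext_of_generator fun α => by
    change (starRingEnd ℂ) (Λ (star (generator α))) = Λ (generator α)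
    rw [star_generator, hΛ, hΛ, loopFunctional_inv, Complex.conj_conj]
  have h' : (starRingEnd ℂ) (Λ (star f)) = Λ f :=
    congrArg (fun L : HolonomyCStarAlgebra M x₀ →L[ℂ] ℂ => L f) h
  rw [← h', Complex.conj_conj]

/-- A unital contractive functional is bounded below on functions that are bounded below. -/
lemma le_re_functional {Λ : HolonomyCStarAlgebra M x₀ →L[ℂ] ℂ} (h1 : Λ 1 = 1)
    (hn : ∀ f, ‖Λ f‖ ≤ ‖f‖) {f : HolonomyCStarAlgebra M x₀} {r : OneForm M → ℝ} {ε : ℝ}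
    (hr : ∀ A, evalAt A f = r A) (hε : ∀ A, ε ≤ r A) : ε ≤ (Λ f).re := by
  have hK : ∀ A, r A ≤ ‖f‖ := fun A => by
    have := norm_evalAt_le A f
    rw [hr, Complex.norm_real] at this
    exact (le_abs_self _).trans this
  -- Pointwise `0 ≤ ‖f‖ - r A ≤ ‖f‖ - ε`; contractivity and `Λ 1 = 1` then give `‖f‖ - (Λ f).re ≤
  -- ‖f‖ - ε`.
  have hb : ‖(‖f‖ : ℂ) • (1 : HolonomyCStarAlgebra M x₀) - f‖ ≤ ‖f‖ - ε := by
    refine norm_le_of_forall_evalAt_le fun A => ?_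
    rw [map_sub, map_smul, map_one, hr, smul_eq_mul, mul_one, ← Complex.ofReal_sub,
      Complex.norm_real, Real.norm_of_nonneg (sub_nonneg.2 (hK A))]
    exact sub_le_sub_left (hε A) _
  have h2 := (Complex.re_le_norm _).trans ((hn _).trans hb)
  rw [map_sub, map_smul, h1, smul_eq_mul, mul_one, Complex.sub_re, Complex.ofReal_re] at h2
  linarith

lemma evalAt_star_mul_self (A : OneForm M) (f : HolonomyCStarAlgebra M x₀) :
    evalAt A (star f * f) = ((‖evalAt A f‖ ^ 2 : ℝ) : ℂ) := by
  rw [map_mul, map_star, RCLike.star_def, RCLike.conj_mul]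
  norm_cast

lemma functional_star_mul_self_im {Λ : HolonomyCStarAlgebra M x₀ →L[ℂ] ℂ}
    (hΛ : ∀ α : Loop M x₀, Λ (generator α) = loopFunctional α) (f : HolonomyCStarAlgebra M x₀) :
    (Λ (star f * f)).im = 0 := by
  rw [← Complex.conj_eq_iff_im, ← functional_star hΛ, star_mul, star_star]

lemma functional_nonneg {Λ : HolonomyCStarAlgebra M x₀ →L[ℂ] ℂ}
    (hΛ : ∀ α : Loop M x₀, Λ (generator α) = loopFunctional α) (hn : ∀ f, ‖Λ f‖ ≤ ‖f‖)
    (f : HolonomyCStarAlgebra M x₀) : 0 ≤ Λ (star f * f) := by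
  rw [Complex.nonneg_iff]
  exact ⟨le_re_functional (functional_one hΛ) hn (fun A => evalAt_star_mul_self A f)
    (fun A => sq_nonneg _), (functional_star_mul_self_im hΛ f).symm⟩

/-- Trigonometric polynomials are almost periodic: finitely many translates approximate all
of them. -/
lemma exists_finset_translates (c : Loop M x₀ →₀ ℂ) {ε : ℝ} (hε : 0 < ε) :
    ∃ F : Finset (OneForm M), ∀ B, ∃ B' ∈ F, ∀ A,
      ‖evalAt (A + B) (trigPolynomial c) - evalAt (A + B') (trigPolynomial c)‖ ≤ ε := by
  classical
  set C := ∑ α ∈ c.support, ‖c α‖ with hC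
  have hC0 : 0 ≤ C := Finset.sum_nonneg fun _ _ => norm_nonneg _
  -- A translation affects the polynomial only through this point of a finite-dimensional torus,
  -- which is compact; `F` consists of preimages of a finite net of the range. In the mesh `ε / (C +
  -- 1)` the `+ 1` guards against `C = 0`.
  let H : OneForm M → (c.support → Circle) := fun B α => holonomy (α : Loop M x₀) B
  have htb : TotallyBounded (range H) := isCompact_univ.totallyBounded.subset (subset_univ _)
  obtain ⟨t, hts, htf, ht⟩ :=
    Metric.finite_approx_of_totallyBounded htb (ε / (C + 1)) (by positivity)
  lift t to Finset (c.support → Circle) using htf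
  obtain ⟨F, -, rfl⟩ := Finset.subset_set_image_iff.1 (hts.trans image_univ.superset)
  refine ⟨F, fun B => ?_⟩
  obtain ⟨_, hB, hd⟩ := mem_iUnion₂.1 (ht ⟨B, rfl⟩)
  obtain ⟨B', hB', rfl⟩ := Finset.mem_image.1 (Finset.mem_coe.1 hB)
  refine ⟨B', hB', fun A => ?_⟩
  rw [evalAt_trigPolynomial, evalAt_trigPolynomial, ← Finset.sum_sub_distrib]
  have hterm : ∀ α ∈ c.support, ‖c α * (holonomy α (A + B) : ℂ) - c α * (holonomy α (A + B') : ℂ)‖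
      ≤ ‖c α‖ * (ε / (C + 1)) := by
    intro α hα
    rw [← mul_sub, norm_mul, holonomy_add, holonomy_add, Circle.coe_mul, Circle.coe_mul, ← mul_sub,
      norm_mul, Circle.norm_coe, one_mul]
    gcongr
    have := (dist_le_pi_dist (H B) (H B') ⟨α, hα⟩).trans (Metric.mem_ball.1 hd).le
    rw [← dist_eq_norm]
    exact this
  refine (norm_sum_le_of_le _ hterm).trans ?_
  rw [← Finset.sum_mul, ← hC, mul_div_assoc', div_le_iff₀ (by positivity)]
  nlinarith

lemma functional_pos {Λ : HolonomyCStarAlgebra M x₀ →L[ℂ] ℂ}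
    (hΛ : ∀ α : Loop M x₀, Λ (generator α) = loopFunctional α) (hn : ∀ f, ‖Λ f‖ ≤ ‖f‖)
    {f : HolonomyCStarAlgebra M x₀} (hf : f ≠ 0) : 0 < Λ (star f * f) := by
  obtain ⟨A₀, hA₀⟩ : ∃ A, evalAt A f ≠ 0 := by
    by_contra! h
    exact hf (ext_evalAt fun A => by rw [h, map_zero])
  set g := star f * f with hg
  let r : OneForm M → ℝ := fun A => ‖evalAt A f‖ ^ 2
  have hr : ∀ A, evalAt A g = r A := fun A => evalAt_star_mul_self A f
  have hr0 : ∀ A, 0 ≤ r A := fun A => sq_nonneg _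
  have hδ : 0 < r A₀ := pow_pos (norm_pos_iff.2 hA₀) 2
  -- Three errors of a quarter each (two approximations, one translation) leave a quarter of `r A₀`.
  obtain ⟨c, hc⟩ := denseRange_trigPolynomial.exists_dist_lt g (show 0 < r A₀ / 4 by positivity)
  obtain ⟨F, hF⟩ := exists_finset_translates c (show 0 < r A₀ / 4 by positivity)
  have hclose : ∀ A, ‖evalAt A g - evalAt A (trigPolynomial c)‖ ≤ r A₀ / 4 := fun A => by
    rw [← map_sub]
    refine (norm_evalAt_le A _).trans ?_
    rw [← dist_eq_norm]
    exact hc.le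
  have hlow : ∀ A, ∃ B ∈ F, r A₀ / 4 ≤ r (A + B) := by
    intro A
    -- Translation by `A₀ - A` would carry `A` exactly to `A₀`; the chosen `B` in `F` imitates it.
    obtain ⟨B, hB, h⟩ := hF (A₀ - A)
    refine ⟨B, hB, ?_⟩
    have h1 := h A
    rw [add_sub_cancel] at h1
    have h2 := hclose A₀
    have h3 := hclose (A + B)
    have h4 : ‖evalAt A₀ g - evalAt (A + B) g‖ ≤ r A₀ / 4 + r A₀ / 4 + r A₀ / 4 := by
      have e : evalAt A₀ g - evalAt (A + B) g =
          (evalAt A₀ g - evalAt A₀ (trigPolynomial c)) +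
          (evalAt A₀ (trigPolynomial c) - evalAt (A + B) (trigPolynomial c)) -
          (evalAt (A + B) g - evalAt (A + B) (trigPolynomial c)) := by ring
      rw [e]
      exact (norm_sub_le _ _).trans (add_le_add ((norm_add_le _ _).trans (add_le_add h2 h1)) h3)
    rw [hr, hr, ← Complex.ofReal_sub, Complex.norm_real] at h4
    have := (le_abs_self _).trans h4
    linarith
  have hsum := le_re_functional (functional_one hΛ) hn
    (f := ∑ B ∈ F, translate B g) (r := fun A => ∑ B ∈ F, r (A + B)) (ε := r A₀ / 4)
    (fun A => by simp only [map_sum, evalAt_translate, hr, Complex.ofReal_sum])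
    (fun A => by
      obtain ⟨B, hB, h⟩ := hlow A
      exact h.trans (Finset.single_le_sum (f := fun B => r (A + B)) (fun B _ => hr0 _) hB))
  -- By invariance the sum of translates has mean `F.card • Λ g`, so `Λ g` cannot vanish.
  simp only [map_sum, functional_translate hΛ, Finset.sum_const] at hsum
  have hne : Λ g ≠ 0 := by
    intro h
    rw [h] at hsum
    simp at hsum
    linarith
  exact lt_of_le_of_ne (functional_nonneg hΛ hn f) hne.symm

end Positivity

section GelfandMeasure

set_option linter.unusedSectionVars false

/-! ### Measures on the Gelfand spectrum -/

open WeakDual CompactlySupported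

variable {A : Type*} [CommCStarAlgebra A]

/-- The element of a commutative C*-algebra with a given Gelfand transform. -/
def ofGelfand (g : C(characterSpace ℂ A, ℂ)) : A :=
  (gelfandStarTransform A).symm g

lemma apply_ofGelfand (g : C(characterSpace ℂ A, ℂ)) (χ : characterSpace ℂ A) :
    χ (ofGelfand g) = g χ :=
  congrArg (fun h : C(characterSpace ℂ A, ℂ) => h χ) ((gelfandStarTransform A).apply_symm_apply g)

lemma eq_of_forall_apply_eq {a b : A} (h : ∀ χ : characterSpace ℂ A, χ a = χ b) : a = b :=
  (gelfandStarTransform A).injective (ContinuousMap.ext h)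

lemma continuous_apply (a : A) : Continuous fun χ : characterSpace ℂ A => χ a :=
  (gelfandStarTransform A a).continuous

/-- The self-adjoint element with a given real-valued Gelfand transform. -/
def ofRealGelfand : C(characterSpace ℂ A, ℝ) →ₗ[ℝ] A where
  toFun g := ofGelfand ⟨fun χ => (g χ : ℂ), Complex.continuous_ofReal.comp g.continuous⟩
  map_add' g h := eq_of_forall_apply_eq fun χ => by simp [apply_ofGelfand]
  map_smul' c g := eq_of_forall_apply_eq fun χ => by
    rw [apply_ofGelfand, RingHom.id_apply, ← Complex.coe_smul, map_smul, apply_ofGelfand]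
    simp

lemma apply_ofRealGelfand (g : C(characterSpace ℂ A, ℝ)) (χ : characterSpace ℂ A) :
    χ (ofRealGelfand g) = (g χ : ℂ) :=
  apply_ofGelfand _ χ

lemma star_ofRealGelfand (g : C(characterSpace ℂ A, ℝ)) :
    star (ofRealGelfand (A := A) g) = ofRealGelfand g :=
  eq_of_forall_apply_eq fun χ => by
    rw [map_star, apply_ofRealGelfand, RCLike.star_def, Complex.conj_ofReal]

/-- Take the square root on the spectrum. This turns positivity on `star a * a` into positivity on
non-negative functions, as the Riesz theorem requires. -/
lemma exists_star_mul_self_eq_ofRealGelfand {g : C(characterSpace ℂ A, ℝ)} (hg : 0 ≤ g) :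
    ∃ a : A, ofRealGelfand g = star a * a := by
  refine ⟨ofRealGelfand ⟨fun χ => √(g χ), g.continuous.sqrt⟩, eq_of_forall_apply_eq fun χ => ?_⟩
  rw [star_ofRealGelfand, map_mul, apply_ofRealGelfand, apply_ofRealGelfand, ← Complex.ofReal_mul]
  exact congrArg _ (Real.mul_self_sqrt (hg χ)).symm

lemma exists_eq_ofRealGelfand_add (a : A) :
    ∃ u v : C(characterSpace ℂ A, ℝ), a = ofRealGelfand u + Complex.I • ofRealGelfand v := by
  refine ⟨⟨fun χ => (χ a).re, Complex.continuous_re.comp (continuous_apply a)⟩,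
    ⟨fun χ => (χ a).im, Complex.continuous_im.comp (continuous_apply a)⟩,
    eq_of_forall_apply_eq fun χ => ?_⟩
  rw [map_add, map_smul, apply_ofRealGelfand, apply_ofRealGelfand, smul_eq_mul, mul_comm]
  exact (Complex.re_add_im _).symm

variable [MeasurableSpace (characterSpace ℂ A)] [BorelSpace (characterSpace ℂ A)]

lemma integrable_apply (μ : Measure (characterSpace ℂ A)) [IsFiniteMeasureOnCompacts μ] (a : A) :
    Integrable (fun χ : characterSpace ℂ A => χ a) μ :=
  (continuous_apply a).integrable_of_hasCompactSupport (HasCompactSupport.of_compactSpace _)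

lemma measure_ext_of_integral_apply {μ ν : Measure (characterSpace ℂ A)} [μ.Regular] [ν.Regular]
    (h : ∀ a : A, ∫ χ : characterSpace ℂ A, χ a ∂μ = ∫ χ : characterSpace ℂ A, χ a ∂ν) :
    μ = ν := by
  refine Measure.ext_of_integral_eq_on_compactlySupported fun g => ?_
  have := h (ofRealGelfand g.toContinuousMap)
  simp only [apply_ofRealGelfand, integral_complex_ofReal] at this
  exact_mod_cast this

/-- The **Riesz representation** of a positive functional on a commutative C*-algebra. -/
lemma exists_regular_measure (Λ : A →L[ℂ] ℂ) (hstar : ∀ a, Λ (star a) = (starRingEnd ℂ) (Λ a))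
    (hpos : ∀ a, 0 ≤ Λ (star a * a)) :
    ∃ μ : Measure (characterSpace ℂ A), μ.Regular ∧
      ∀ a, Λ a = ∫ χ : characterSpace ℂ A, χ a ∂μ := by
  let L : C_c(characterSpace ℂ A, ℝ) →ₗ[ℝ] ℝ :=
    { toFun := fun g => (Λ (ofRealGelfand g.toContinuousMap)).re
      map_add' := fun g h => by
        rw [← Complex.add_re, ← map_add, ← map_add]
        rfl
      map_smul' := fun c g => by
        have : ofRealGelfand (A := A) (c • g).toContinuousMap =
            (c : ℂ) • ofRealGelfand g.toContinuousMap := by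
          rw [Complex.coe_smul, ← map_smul]
          rfl
        rw [this, map_smul]
        simp }
  let L' : C_c(characterSpace ℂ A, ℝ) →ₚ[ℝ] ℝ := PositiveLinearMap.mk₀ L fun g hg => by
    obtain ⟨a, ha⟩ := exists_star_mul_self_eq_ofRealGelfand (A := A) (g := g.toContinuousMap) hg
    change 0 ≤ (Λ (ofRealGelfand g.toContinuousMap)).re
    rw [ha]
    exact (Complex.nonneg_iff.1 (hpos a)).1
  have hreal : ∀ g : C(characterSpace ℂ A, ℝ),
      Λ (ofRealGelfand g) = ∫ χ : characterSpace ℂ A, χ (ofRealGelfand g) ∂(RealRMK.rieszMeasure L') := by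
    intro g
    simp only [apply_ofRealGelfand, integral_complex_ofReal]
    have h1 := RealRMK.integral_rieszMeasure L' (CompactlySupportedContinuousMap.continuousMapEquiv g)
    have h2 : ∫ χ, g χ ∂(RealRMK.rieszMeasure L') = (Λ (ofRealGelfand g)).re := h1
    rw [h2]
    -- Taking real parts in `L` lost nothing: `Λ` is real on self-adjoint elements.
    refine (Complex.conj_eq_iff_re.1 ?_).symm
    rw [← hstar, star_ofRealGelfand]
  refine ⟨RealRMK.rieszMeasure L', inferInstance, fun a => ?_⟩
  obtain ⟨u, v, rfl⟩ := exists_eq_ofRealGelfand_add a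
  simp only [map_add, map_smul, hreal]
  rw [← integral_smul]
  exact (integral_add (integrable_apply _ _) ((integrable_apply _ _).smul Complex.I)).symm

/-! ### Total mass, faithfulness and invariance of a representing measure. -/

variable {μ : Measure (characterSpace ℂ A)} {Λ : A →L[ℂ] ℂ}

lemma isProbabilityMeasure_of_integral_apply
    (hμ : ∀ a, Λ a = ∫ χ : characterSpace ℂ A, χ a ∂μ) (h1 : Λ 1 = 1) :
    IsProbabilityMeasure μ := by
  have h := hμ 1
  simp only [h1, map_one, integral_const, Complex.real_smul, mul_one] at h
  refine ⟨?_⟩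
  -- This also excludes infinite mass, for which `μ.real univ` would be `0`.
  have h2 : μ.real univ = 1 := by exact_mod_cast h.symm
  exact (ENNReal.toReal_eq_one_iff _).1 h2

lemma eq_zero_of_ae_apply_eq_zero (hμ : ∀ a, Λ a = ∫ χ : characterSpace ℂ A, χ a ∂μ)
    (hpos : ∀ a, a ≠ 0 → 0 < Λ (star a * a)) {a : A}
    (h : ∀ᵐ χ : characterSpace ℂ A ∂μ, χ a = 0) : a = 0 := by
  by_contra ha
  refine (hpos a ha).ne' ?_
  rw [hμ]
  refine integral_eq_zero_of_ae (h.mono fun χ hχ => ?_)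
  simp [hχ]

/-- A Urysohn function that vanishes off a null open set is the Gelfand transform of an element
vanishing almost everywhere, yet it equals `1` at a point. -/
lemma isOpenPosMeasure_of_faithful (h : ∀ a : A, (∀ᵐ χ : characterSpace ℂ A ∂μ, χ a = 0) → a = 0) :
    μ.IsOpenPosMeasure := by
  refine ⟨fun U hU ⟨χ₀, hχ₀⟩ hU0 => ?_⟩
  obtain ⟨g, hg0, hg1, -⟩ := exists_continuous_zero_one_of_isClosed hU.isClosed_compl
    (isClosed_singleton (x := χ₀)) (by simpa using hχ₀)
  have hz : ofRealGelfand (A := A) g = 0 := by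
    refine h _ ?_
    filter_upwards [measure_eq_zero_iff_ae_notMem.1 hU0] with χ hχ
    rw [apply_ofRealGelfand, hg0 hχ]
    simp
  have := apply_ofRealGelfand g χ₀
  rw [hz, map_zero, hg1 (mem_singleton χ₀)] at this
  simp at this

/-- An automorphism of a commutative C*-algebra induces a homeomorphism of the spectrum. -/
def spectrumHomeomorph (Φ : A ≃⋆ₐ[ℂ] A) : characterSpace ℂ A ≃ₜ characterSpace ℂ A where
  toFun := CharacterSpace.compContinuousMap (Φ : A →⋆ₐ[ℂ] A)
  invFun := CharacterSpace.compContinuousMap (Φ.symm : A →⋆ₐ[ℂ] A)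
  left_inv χ := CharacterSpace.ext fun a => congrArg χ (Φ.apply_symm_apply a)
  right_inv χ := CharacterSpace.ext fun a => congrArg χ (Φ.symm_apply_apply a)
  continuous_toFun := ContinuousMap.continuous _
  continuous_invFun := ContinuousMap.continuous _

/-- The pushforward is regular and represents `Λ ∘ Φ = Λ`, so uniqueness of the representing measure
applies. -/
lemma map_spectrumHomeomorph [μ.Regular] (hμ : ∀ a, Λ a = ∫ χ : characterSpace ℂ A, χ a ∂μ)
    (Φ : A ≃⋆ₐ[ℂ] A) (hΦ : ∀ a, Λ (Φ a) = Λ a) : μ.map (spectrumHomeomorph Φ) = μ := by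
  have := Measure.Regular.map (μ := μ) (spectrumHomeomorph Φ)
  refine measure_ext_of_integral_apply fun a => ?_
  rw [(spectrumHomeomorph Φ).isClosedEmbedding.measurableEmbedding.integral_map, ← hμ, ← hΦ, hμ]
  rfl

end GelfandMeasure

end

end U1Holonomy

theorem theoremA5 {M : Type*} [TopologicalSpace M] [T2Space M] [SigmaCompactSpace M]
    [ConnectedSpace M] [ChartedSpace (EuclideanSpace ℝ (Fin 3)) M] [IsManifold (𝓡 3) ∞ M] (x₀ : M) :
    ∃ Λ : U1Holonomy.HolonomyCStarAlgebra M x₀ →L[ℂ] ℂ,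
      -- `Λ` extends the loop functional, and is the only continuous linear functional doing so
      (∀ α : U1Holonomy.Loop M x₀,
        Λ (U1Holonomy.generator α) = U1Holonomy.loopFunctional α) ∧
      (∀ Λ' : U1Holonomy.HolonomyCStarAlgebra M x₀ →L[ℂ] ℂ,
        (∀ α : U1Holonomy.Loop M x₀,
          Λ' (U1Holonomy.generator α) = U1Holonomy.loopFunctional α) → Λ' = Λ) ∧
      -- `Λ` is positive, and strictly so
      (∀ f, 0 ≤ Λ (star f * f)) ∧
      (∀ f, f ≠ 0 → 0 < Λ (star f * f)) ∧
      -- the regular measure on the spectrum given by `Λ`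
      ∃ μ : Measure (U1Holonomy.Spectrum M x₀),
        μ.Regular ∧ IsProbabilityMeasure μ ∧
        (∀ f, Integrable (fun χ : U1Holonomy.Spectrum M x₀ => χ f) μ ∧ Λ f = ∫ χ, χ f ∂μ) ∧
        (∀ ν : Measure (U1Holonomy.Spectrum M x₀), ν.Regular →
          (∀ f, Λ f = ∫ χ, χ f ∂ν) → ν = μ) ∧
        -- it is strictly positive, and multiplication by Gelfand transforms is faithful
        μ.IsOpenPosMeasure ∧
        (∀ f, (∀ᵐ χ : U1Holonomy.Spectrum M x₀ ∂μ, χ f = 0) → f = 0) ∧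
        -- every diffeomorphism acts on the algebra, leaving `Λ` and `μ` invariant
        ∀ φ : M ≃ₘ^∞⟮𝓡 3, 𝓡 3⟯ M,
          ∃ Φ : U1Holonomy.HolonomyCStarAlgebra M x₀ ≃⋆ₐ[ℂ] U1Holonomy.HolonomyCStarAlgebra M x₀,
            U1Holonomy.IsInducedBy Φ φ ∧
            (∀ f, Λ (Φ f) = Λ f) ∧
            μ.map (U1Holonomy.spectrumMap Φ) = μ := by
  open U1Holonomy in
  obtain ⟨Λ, hΛ, hn⟩ := exists_functional (x₀ := x₀)
  have hpos : ∀ f, f ≠ 0 → 0 < Λ (star f * f) := fun f => functional_pos hΛ hn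
  obtain ⟨μ, hreg, hμ⟩ := exists_regular_measure Λ (functional_star hΛ) (functional_nonneg hΛ hn)
  have hfaithful : ∀ f, (∀ᵐ χ : Spectrum M x₀ ∂μ, χ f = 0) → f = 0 :=
    fun f => eq_zero_of_ae_apply_eq_zero hμ hpos
  exact ⟨Λ, hΛ, fun Λ' h => ext_of_generator fun α => (h α).trans (hΛ α).symm,
    functional_nonneg hΛ hn, hpos, μ, hreg,
    isProbabilityMeasure_of_integral_apply hμ (functional_one hΛ),
    fun f => ⟨integrable_apply μ f, hμ f⟩,
    fun ν _ h => measure_ext_of_integral_apply fun f => (h f).symm.trans (hμ f),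
    isOpenPosMeasure_of_faithful hfaithful, hfaithful,
    fun φ => ⟨pullbackEquiv φ, isInducedBy_pullbackEquiv φ, functional_pullbackEquiv hΛ φ,
      map_spectrumHomeomorph hμ (pullbackEquiv φ) (functional_pullbackEquiv hΛ φ)⟩⟩
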